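/- Let $M$ be a smooth Riemannian manifold (finite-dimensional, Hausdorff, without boundary), $\Sigma\subset M$ a compact set, $b\in\mathbb R$, and $g:M\setminus\Sigma\to\mathbb R$ a $C^2$ function which is fast decreasing at $\Sigma$ under level $b$. This means that 1. $\lim_{x\to z,\ x\in M\setminus\Sigma} g(x)=-\infty$ for every $z\in\Sigma$; and 2. there is a strictly positive continuous function $\phi:(-\infty,b]\to\mathbb R$ that has a bounded primitive on $(-\infty,b]$, such that $\|\nabla g(x)\|>1/\phi(g(x))$ for every $x\in M\setminus\Sigma$ with $g(x)\le b$. Assume also that the set $A=g^{-1}((-\infty,b])\cup\Sigma$ is compact. Then $\Sigma$ is a strong deformation retract of $A$, that is, there is a continuous map $F:[0,1]\times A\to A$ such that $F(0,x)=x$ and $F(1,x)\in\Sigma$ for all $x\in A$, and $F(t,z)=z$ for all $z\in\Sigma$ and $t\in[0,1]$. -/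

import Mathlib

open scoped Manifold ContDiff Topology Bundle

noncomputable section

/-- A subset `S` of a topological space is a strong deformation retract of `A`: it is contained in
`A`, and the identity of `A` is homotopic, through maps `A → A` that fix every point of `S` at
every time, to a map with values in `S`. (That map then is a retraction of `A` onto `S`.) -/
def IsStrongDeformationRetract {X : Type*} [TopologicalSpace X] (S A : Set X) : Prop :=
  S ⊆ A ∧ ∃ r : C(A, A), (∀ x : A, (r x : X) ∈ S) ∧
    (ContinuousMap.id A).HomotopicRel r {x : A | (x : X) ∈ S}

section Gradient

variable {E : Type*} [NormedAddCommGroup E] [NormedSpace ℝ E] [FiniteDimensional ℝ E]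
  {H : Type*} [TopologicalSpace H] (I : ModelWithCorners ℝ E H)
  {M : Type*} [TopologicalSpace M] [ChartedSpace H M]
  [Bundle.RiemannianBundle (fun x : M => TangentSpace I x)]

/-- The Riemannian gradient of `g` at `x`: the tangent vector that represents the differential
of `g` at `x` through the inner product of the tangent space. -/
def riemannianGradient (g : M → ℝ) (x : M) : TangentSpace I x :=
  haveI : FiniteDimensional ℝ (TangentSpace I x) := inferInstanceAs (FiniteDimensional ℝ E)
  haveI : CompleteSpace (TangentSpace I x) := FiniteDimensional.complete ℝ (TangentSpace I x)
  (InnerProductSpace.toDual ℝ (TangentSpace I x)).symm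
    ((NormedSpace.fromTangentSpace (𝕜 := ℝ) (g x)).toContinuousLinearMap.comp (mfderiv I 𝓘(ℝ, ℝ) g x))

/-- The function `g`, which is regarded as a function on the complement of `S` only (its values
on `S` are irrelevant), is fast decreasing at `S` under level `b`. Here `φ` is only relevant on
`(-∞, b]`, and `Φ` is a bounded primitive of `φ` there. -/
structure IsFastDecreasing (S : Set M) (g : M → ℝ) (b : ℝ) : Prop where
  tendsto_atBot : ∀ z ∈ S, Filter.Tendsto g (𝓝[Sᶜ] z) Filter.atBot
  exists_lt_norm_gradient : ∃ φ : ℝ → ℝ,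
    ContinuousOn φ (Set.Iic b) ∧ (∀ t ≤ b, 0 < φ t) ∧
    (∃ Φ : ℝ → ℝ, (∀ t ≤ b, HasDerivWithinAt Φ (φ t) (Set.Iic b) t) ∧
      ∃ C : ℝ, ∀ t ≤ b, |Φ t| ≤ C) ∧
    ∀ x ∉ S, g x ≤ b → 1 / φ (g x) < ‖riemannianGradient I g x‖

end Gradient

end

/-! The deformation is built without any flow. Let `Φ` be a bounded primitive of `φ`, with limit `m`
at `-∞`. The potential `w`, equal to `Φ ∘ g - m` off `S` and to `0` on `S`, is continuous and
nonnegative on the compact set `A`, and its zeros are the points of `S`. Along the direction `-∇g`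
the potential decreases at the rate `φ(g) ‖∇g‖`, per unit of length, and this is more than `1`.
This strict inequality is an open condition: near a point of `A \ S` it remains true along parallel
segments in a chart. Hence sliding along such segments is a local homotopy that moves each
point, for the Riemannian distance, by at most the amount by which it lowers `w`
(`exists_local_descent`).

The rest takes place in a compact metric space. Homotopies with this property (`IsDescent`) can be
cut off to the whole space, and composed, by the triangle inequality. They fix the zeros of `w`,
as `w` cannot go down there. By compactness finitely many of them can be composed to bring `w` below
a given `ε > 0` everywhere (`exists_isDescent_le`). Running such homotopies for a sequence of `ε`
that tends to `0`, the displacement that is still to come is at most the current value of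
`w`, so the infinite composition converges uniformly, and it ends in `S`
(`exists_deformation_onto_zeros`). -/

open scoped NNReal ENNReal unitInterval

/-! ### Descent homotopies of a compact metric space -/

section Descent

variable {X : Type*} [EMetricSpace X] {w : X → ℝ≥0}

/-- A homotopy `L` of maps `X → X`, starting at the identity, is a descent homotopy for the
potential `w` if it moves each point by at most the amount by which it lowers `w` there. -/
structure IsDescent (w : X → ℝ≥0) (L : C(I × X, X)) : Prop where
  apply_zero : ∀ p, L (0, p) = p
  edist_add_le : ∀ t p, edist p (L (t, p)) + w (L (t, p)) ≤ w p

namespace IsDescent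

variable {L L' : C(I × X, X)}

theorem le (h : IsDescent w L) (t : I) (p : X) : w (L (t, p)) ≤ w p := by
  have := le_trans le_add_self (h.edist_add_le t p)
  exact_mod_cast this

theorem lt_of_ne (h : IsDescent w L) {t : I} {p : X} (hne : L (t, p) ≠ p) :
    w (L (t, p)) < w p := by
  have h1 : (w (L (t, p)) : ℝ≥0∞) < edist p (L (t, p)) + w (L (t, p)) :=
    by
    rw [add_comm]
    exact ENNReal.lt_add_right ENNReal.coe_ne_top (edist_pos.2 hne.symm).ne'
  exact_mod_cast h1.trans_le (h.edist_add_le t p)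

theorem apply_eq_self (h : IsDescent w L) {p : X} (hp : w p = 0) (t : I) : L (t, p) = p := by
  by_contra hne
  simpa [hp] using h.lt_of_ne hne

variable (w) in
theorem snd : IsDescent w (ContinuousMap.snd : C(I × X, X)) :=
  ⟨fun _ => rfl, fun t p => by simp⟩

/-- Running two descent homotopies after each other, the second one with its clock changed by a
map that fixes `0`, gives a descent homotopy, by the triangle inequality. -/
theorem comp (h' : IsDescent w L') (h : IsDescent w L) (c : C(I, I)) (hc : c 0 = 0) :
    IsDescent w (L'.comp ((c.comp .fst).prodMk L)) where
  apply_zero p := by simp [hc, h.apply_zero, h'.apply_zero]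
  edist_add_le t p := by
    have h1 := h.edist_add_le t p
    have h2 := h'.edist_add_le (c t) (L (t, p))
    simp only [ContinuousMap.comp_apply, ContinuousMap.prod_eval, ContinuousMap.fst_apply]
    calc edist p (L' (c t, L (t, p))) + w (L' (c t, L (t, p)))
        ≤ edist p (L (t, p)) + (edist (L (t, p)) (L' (c t, L (t, p))) + w (L' (c t, L (t, p)))) := by
          rw [← add_assoc]; gcongr; exact edist_triangle _ _ _
      _ ≤ edist p (L (t, p)) + w (L (t, p)) := by gcongr
      _ ≤ w p := h1

end IsDescent

/-- Finitely many descent homotopies can be run after each other, so that on a compact set some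
time-one map lowers the potential everywhere: a point that an earlier homotopy has moved at all
has been lowered by it, and otherwise the next one starts from the original point. -/
theorem exists_isDescent_lt_on_compact (hw : Continuous w) {K : Set X} (hK : IsCompact K)
    (hloc : ∀ x ∈ K, ∃ L : C(I × X, X), IsDescent w L ∧ w (L (1, x)) < w x) :
    ∃ L : C(I × X, X), IsDescent w L ∧ ∀ p ∈ K, w (L (1, p)) < w p := by
  refine hK.induction_on (p := fun s => ∃ L : C(I × X, X), IsDescent w L ∧
    ∀ p ∈ s, w (L (1, p)) < w p) ⟨_, .snd w, by simp⟩ (fun s t hst ht => ?_)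
    (fun s t hs ht => ?_) fun x hx => ?_
  · obtain ⟨L, hL, h⟩ := ht
    exact ⟨L, hL, fun p hp => h p (hst hp)⟩
  · obtain ⟨L, hL, h⟩ := hs
    obtain ⟨L', hL', h'⟩ := ht
    refine ⟨_, hL'.comp hL (.id I) rfl, fun p hp => ?_⟩
    simp only [ContinuousMap.comp_apply, ContinuousMap.prod_eval, ContinuousMap.fst_apply,
      ContinuousMap.id_apply]
    rcases hp with hp | hp
    · exact (hL'.le _ _).trans_lt (h p hp)
    · by_cases hne : L (1, p) = p
      · rw [hne]; exact h' p hp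
      · exact (hL'.le _ _).trans_lt (hL.lt_of_ne hne)
  · obtain ⟨L, hL, h⟩ := hloc x hx
    have hc : Continuous fun p => w (L (1, p)) := by fun_prop
    exact ⟨_, mem_nhdsWithin_of_mem_nhds ((isOpen_lt hc hw).mem_nhds h), L, hL, fun p hp => hp⟩

variable [CompactSpace X]

/-- A descent homotopy that is only defined near `x` can be cut off, by slowing down its clock, to
one of the whole space that is the same at `x`. -/
theorem exists_isDescent_of_local {x : X} {V : Set X} (hV : IsOpen V) (hx : x ∈ V)
    (L : I × X → X) (hL : ContinuousOn L (Set.univ ×ˢ V)) (h0 : ∀ p ∈ V, L (0, p) = p)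
    (hle : ∀ t, ∀ p ∈ V, edist p (L (t, p)) + w (L (t, p)) ≤ w p) :
    ∃ L' : C(I × X, X), IsDescent w L' ∧ L' (1, x) = L (1, x) := by
  classical
  obtain ⟨χ, hχs, hχ1, hχI⟩ := exists_tsupport_one_of_isOpen_isClosed hV
    isClosed_closure.isCompact (isClosed_singleton (x := x)) (by simpa using hx)
  have hχ1 : χ x = 1 := hχ1 rfl
  let c : I × X → I := fun q => q.1 * ⟨χ q.2, hχI q.2⟩
  have hc : Continuous c := by fun_prop
  let f : I × X → X := fun q => if q.2 ∈ V then L (c q, q.2) else q.2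
  have hf : Continuous f := by
    rw [continuous_iff_continuousAt]
    rintro ⟨t, p⟩
    by_cases hp : p ∈ V
    · have h1 : ContinuousAt (fun q : I × X => L (c q, q.2)) (t, p) := by
        have h2 : ContinuousAt L (c (t, p), p) :=
          hL.continuousAt (by
            rw [nhds_prod_eq]
            exact Filter.prod_mem_prod Filter.univ_mem (hV.mem_nhds hp))
        exact ContinuousAt.comp (f := fun q : I × X => (c q, q.2)) h2
          (hc.continuousAt.prodMk continuousAt_snd)
      refine h1.congr ?_
      filter_upwards [continuousAt_snd.preimage_mem_nhds (hV.mem_nhds hp)] with q hq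
      exact (if_pos hq).symm
    · have hp' : p ∈ (tsupport χ)ᶜ := fun h => hp (hχs h)
      refine (continuousAt_snd (p := (t, p))).congr ?_
      filter_upwards [continuousAt_snd.preimage_mem_nhds
        ((isClosed_tsupport χ).isOpen_compl.mem_nhds hp')] with q hq
      have hq0 : χ q.2 = 0 := image_eq_zero_of_notMem_tsupport hq
      by_cases hqV : q.2 ∈ V
      · have : c q = 0 := by
          ext; simp [c, hq0]
        simp [f, this, h0 _ hqV]
      · simp [f, hqV]
  refine ⟨⟨f, hf⟩, ⟨fun p => ?_, fun t p => ?_⟩, ?_⟩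
  · by_cases hp : p ∈ V
    · have : c (0, p) = 0 := by simp [c]
      simp [f, hp, this, h0 p hp]
    · simp [f, hp]
  · by_cases hp : p ∈ V
    · simpa [f, hp] using hle (c (t, p)) p hp
    · simp [f, hp]
  · have : c (1, x) = 1 := by ext; simp [c, hχ1]
    simp [f, hx, this]

/-- A homotopy that lowers `w` at all points of the compact set `{ε ≤ w}` lowers it there by a
definite amount, so that finitely many repetitions bring `w` below `ε`. -/
theorem exists_isDescent_le (hw : Continuous w)
    (hloc : ∀ x, w x ≠ 0 → ∃ L : C(I × X, X), IsDescent w L ∧ w (L (1, x)) < w x)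
    {ε : ℝ≥0} (hε : 0 < ε) :
    ∃ L : C(I × X, X), IsDescent w L ∧ ∀ p, w (L (1, p)) ≤ ε := by
  have hK : IsCompact {p | ε ≤ w p} := (isClosed_le continuous_const hw).isCompact
  obtain ⟨L, hL, hlt⟩ := exists_isDescent_lt_on_compact hw hK
    fun x hx => hloc x (hε.trans_le hx).ne'
  obtain ⟨δ, hδ, hdrop⟩ := hK.exists_forall_le' (f := fun p => w p - w (L (1, p)))
    (by fun_prop) (a := 0) fun p hp => tsub_pos_of_lt (hlt p hp)
  have key : ∀ k : ℕ, ∃ L' : C(I × X, X), IsDescent w L' ∧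
      ∀ p, w (L' (1, p)) ≤ max ε (w p - k * δ) := by
    intro k
    induction k with
    | zero => exact ⟨_, .snd w, by simp⟩
    | succ k ih =>
      obtain ⟨L', hL', h'⟩ := ih
      refine ⟨_, hL.comp hL' (.id I) rfl, fun p => ?_⟩
      simp only [ContinuousMap.comp_apply, ContinuousMap.prod_eval, ContinuousMap.fst_apply,
        ContinuousMap.id_apply]
      set q := L' (1, p)
      have hq : w q ≤ max ε (w p - k * δ) := h' p
      rcases lt_or_ge (w q) ε with hqε | hqε
      · exact le_max_of_le_left ((hL.le _ _).trans hqε.le)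
      · have h1 : w (L (1, q)) ≤ w q - δ := by
          have h2 : δ ≤ w q - w (L (1, q)) := hdrop q hqε
          have h3 := hL.le 1 q
          rw [le_tsub_iff_left h3] at h2
          exact le_tsub_of_add_le_right h2
        refine h1.trans ?_
        rcases le_max_iff.1 hq with hq | hq
        · exact le_max_of_le_left (tsub_le_self.trans hq)
        · refine le_max_of_le_right ?_
          push_cast
          rw [add_mul, one_mul, ← tsub_tsub]
          exact tsub_le_tsub_right hq δ
  obtain ⟨W, hW⟩ := (isCompact_range hw).bddAbove
  obtain ⟨k, hk⟩ := exists_nat_gt (W / δ)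
  obtain ⟨L', hL', h'⟩ := key k
  refine ⟨L', hL', fun p => (h' p).trans ?_⟩
  have : w p ≤ k * δ := (hW ⟨p, rfl⟩).trans ((div_le_iff₀ hδ).1 hk.le)
  simp [tsub_eq_zero_of_le this]

/-- Continuous clocks, the `m`-th of which only starts after those before it have stopped. -/
theorem exists_successive_clocks : ∃ c : ℕ → C(I, I), (∀ n, c n 0 = 0) ∧ (∀ n, c n 1 = 1) ∧
    ∀ t n, c n t = 1 ∨ ∀ m > n, c m t = 0 := by
  -- the `n`-th clock runs between the times `n / (n + 1)` and `(n + 1) / (n + 2)`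
  refine ⟨fun n => ⟨fun t => Set.projIcc (0 : ℝ) 1 zero_le_one
    ((n + 2) * ((n + 1) * (t : ℝ) - n)), continuous_projIcc.comp (by fun_prop)⟩,
    fun n => ?_, fun n => ?_, fun t n => ?_⟩
  · refine Set.projIcc_of_le_left zero_le_one ?_
    have : (0 : ℝ) ≤ n := n.cast_nonneg
    simp
    nlinarith
  · refine Set.projIcc_of_right_le zero_le_one ?_
    have : (0 : ℝ) ≤ n := n.cast_nonneg
    simp
    nlinarith
  · rcases le_or_gt 1 (((n : ℝ) + 2) * ((n + 1) * (t : ℝ) - n)) with h | h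
    · exact .inl (Set.projIcc_of_right_le zero_le_one h)
    · refine .inr fun m hm => Set.projIcc_of_le_left zero_le_one ?_
      have hn : (0 : ℝ) ≤ n := n.cast_nonneg
      have hm : (n : ℝ) + 1 ≤ m := by exact_mod_cast hm
      have h1 : ((n : ℝ) + 2) * t ≤ n + 1 := by
        by_contra! h2
        nlinarith
      have h3 : ((m : ℝ) + 1) * t ≤ m := by
        have := t.2.2
        nlinarith
      refine mul_nonpos_of_nonneg_of_nonpos (by linarith) (by linarith)

/-- Running infinitely many descent homotopies one after the other, the `n`-th of which ends where
`w ≤ 1 / (n + 1)`, deforms the whole space into the zero set of `w`. The displacement that is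
still to come is bounded by the remaining value of `w`, so that the limit is uniform. -/
theorem exists_deformation_onto_zeros (hw : Continuous w)
    (hloc : ∀ x, w x ≠ 0 → ∃ L : C(I × X, X), IsDescent w L ∧ w (L (1, x)) < w x) :
    ∃ G : C(I × X, X), (∀ p, G (0, p) = p) ∧ (∀ p, w (G (1, p)) = 0) ∧
      ∀ t p, w p = 0 → G (t, p) = p := by
  obtain ⟨c, hc0, hc1, hc⟩ := exists_successive_clocks
  let ε : ℕ → ℝ≥0 := fun n => 1 / ((n : ℝ≥0) + 1)
  have hε : ∀ n, 0 < ε n := fun n => Nat.one_div_pos_of_nat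
  have hε0 : Filter.Tendsto ε Filter.atTop (𝓝 0) := tendsto_one_div_add_atTop_nhds_zero_nat
  choose L hL hLε using fun n => exists_isDescent_le hw hloc (hε n)
  let F : ℕ → C(I × X, X) := fun n => Nat.rec .snd
    (fun n Fn => (L n).comp (((c n).comp .fst).prodMk Fn)) n
  have hFs : ∀ n t p, F (n + 1) (t, p) = L n (c n t, F n (t, p)) := fun n t p => rfl
  have hF : ∀ n, IsDescent w (F n) := by
    intro n
    induction n with
    | zero => exact .snd w
    | succ n ih => exact (hL n).comp ih (c n) (hc0 n)
  have hmono : ∀ t p n k, edist (F n (t, p)) (F (n + k) (t, p)) + w (F (n + k) (t, p)) ≤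
      w (F n (t, p)) := by
    intro t p n k
    induction k with
    | zero => simp
    | succ k ih =>
      have h1 := (hL (n + k)).edist_add_le (c (n + k) t) (F (n + k) (t, p))
      rw [← hFs] at h1
      calc edist (F n (t, p)) (F (n + k + 1) (t, p)) + w (F (n + k + 1) (t, p))
          ≤ edist (F n (t, p)) (F (n + k) (t, p)) + (edist (F (n + k) (t, p))
            (F (n + k + 1) (t, p)) + w (F (n + k + 1) (t, p))) := by
            rw [← add_assoc]; gcongr; exact edist_triangle _ _ _
        _ ≤ edist (F n (t, p)) (F (n + k) (t, p)) + w (F (n + k) (t, p)) := by gcongr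
        _ ≤ _ := ih
  have htail : ∀ q n m, n + 1 ≤ m → edist (F (n + 1) q) (F m q) ≤ ε n := by
    rintro ⟨t, p⟩ n m hm
    obtain ⟨k, rfl⟩ := Nat.exists_eq_add_of_le hm
    rcases hc t n with h | h
    · have h1 : w (F (n + 1) (t, p)) ≤ ε n := by
        rw [hFs, h]; exact hLε n _
      exact (le_self_add.trans (hmono t p (n + 1) k)).trans (by exact_mod_cast h1)
    · have h1 : F (n + 1 + k) (t, p) = F (n + 1) (t, p) := by
        clear hm
        induction k with
        | zero => rfl
        | succ k ih => rw [← add_assoc, hFs, h _ (by omega), (hL _).apply_zero, ih]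
      simp [h1]
  have hε0' : Filter.Tendsto (fun n => 2 * (ε n : ℝ≥0∞)) Filter.atTop (𝓝 0) := by
    have h1 : Filter.Tendsto (fun n => ((2 * ε n : ℝ≥0) : ℝ≥0∞)) Filter.atTop (𝓝 ((2 * 0 : ℝ≥0))) :=
      ENNReal.tendsto_coe.2 (hε0.const_mul 2)
    simpa using h1
  have hlim : ∀ q, ∃ y, Filter.Tendsto (fun n => F (n + 1) q) Filter.atTop (𝓝 y) := fun q =>
    cauchySeq_tendsto_of_complete <| EMetric.cauchySeq_iff_le_tendsto_0.2
      ⟨fun n => 2 * (ε n : ℝ≥0∞), fun n m N hn hm => by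
        refine le_of_le_of_eq ?_ (two_mul (ε N : ℝ≥0∞)).symm
        refine (edist_triangle_left _ _ (F (N + 1) q)).trans (add_le_add ?_ ?_)
        · exact htail q N (n + 1) (by omega)
        · exact htail q N (m + 1) (by omega), hε0'⟩
  choose G hG using hlim
  have hunif : TendstoUniformly (fun n q => F (n + 1) q) G Filter.atTop := by
    rw [EMetric.tendstoUniformly_iff]
    intro η hη
    have h1 : ∀ n q, edist (F (n + 1) q) (G q) ≤ ε n := fun n q =>
      le_of_tendsto (tendsto_const_nhds.edist (hG q))
        (Filter.eventually_atTop.2 ⟨n, fun m hm => htail q n (m + 1) (by omega)⟩)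
    have h2 : Filter.Tendsto (fun n => (ε n : ℝ≥0∞)) Filter.atTop (𝓝 0) := by
      simpa using ENNReal.tendsto_coe.2 hε0
    filter_upwards [h2.eventually_lt_const hη] with n hn q
    rw [edist_comm]
    exact (h1 n q).trans_lt hn
  have hGc : Continuous G :=
    hunif.continuous (Filter.Frequently.of_forall fun n => (F (n + 1)).continuous)
  refine ⟨⟨G, hGc⟩, fun p => ?_, fun p => ?_, fun t p hp => ?_⟩
  · refine tendsto_nhds_unique (hG (0, p)) ?_
    simp [(hF _).apply_zero]
  · have h1 : Filter.Tendsto (fun n => w (F (n + 1) (1, p))) Filter.atTop (𝓝 (w (G (1, p)))) :=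
      (hw.tendsto _).comp (hG (1, p))
    refine tendsto_nhds_unique h1 (tendsto_of_tendsto_of_tendsto_of_le_of_le tendsto_const_nhds hε0
      (fun n => zero_le) fun n => ?_)
    simp only [hFs, hc1]
    exact hLε n _
  · refine tendsto_nhds_unique (hG (t, p)) ?_
    simp [(hF _).apply_eq_self hp]

end Descent

/-! ### Segments in a chart along the negative gradient -/

section Chart

variable {E : Type*} [NormedAddCommGroup E] [NormedSpace ℝ E]
  {M : Type*} [TopologicalSpace M] [ChartedSpace E M]

/-- In the chart at `x` the coordinates of a tangent vector at `x` are the vector itself, because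
`TangentSpace` unfolds to the model space. -/
theorem fderiv_comp_extChartAt_symm {g : M → ℝ} {x : M}
    (hg : MDifferentiableAt 𝓘(ℝ, E) 𝓘(ℝ, ℝ) g x) (u : E) :
    fderiv ℝ (g ∘ (extChartAt 𝓘(ℝ, E) x).symm) (extChartAt 𝓘(ℝ, E) x x) u =
      (mfderiv 𝓘(ℝ, E) 𝓘(ℝ, ℝ) g x u : ℝ) := by
  have h := hg.mfderiv
  have h2 : writtenInExtChartAt 𝓘(ℝ, E) 𝓘(ℝ, ℝ) x g = g ∘ (extChartAt 𝓘(ℝ, E) x).symm := by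
    rfl
  rw [h2, modelWithCornersSelf_coe, Set.range_id, fderivWithin_univ] at h
  exact congr($h.symm u)

variable [Bundle.RiemannianBundle (fun x : M => TangentSpace 𝓘(ℝ, E) x)]

theorem inner_riemannianGradient [FiniteDimensional ℝ E] (g : M → ℝ) (x : M)
    (u : TangentSpace 𝓘(ℝ, E) x) :
    inner ℝ (riemannianGradient 𝓘(ℝ, E) g x) u = (mfderiv 𝓘(ℝ, E) 𝓘(ℝ, ℝ) g x u : ℝ) := by
  have : FiniteDimensional ℝ (TangentSpace 𝓘(ℝ, E) x) := inferInstanceAs (FiniteDimensional ℝ E)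
  have : CompleteSpace (TangentSpace 𝓘(ℝ, E) x) := FiniteDimensional.complete ℝ _
  rw [riemannianGradient, InnerProductSpace.toDual_symm_apply]
  rfl

theorem Bundle.IsContMDiffRiemannianBundle.isContinuousRiemannianBundle {n : ℕ∞ω}
    [IsManifold 𝓘(ℝ, E) 1 M]
    (h : IsContMDiffRiemannianBundle 𝓘(ℝ, E) n E (fun x : M => TangentSpace 𝓘(ℝ, E) x)) :
    IsContinuousRiemannianBundle E (fun x : M => TangentSpace 𝓘(ℝ, E) x) := by
  obtain ⟨G, hG, h⟩ := h.exists_contMDiff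
  exact ⟨G, hG.continuous, h⟩

variable [IsManifold 𝓘(ℝ, E) 1 M]
  [IsContinuousRiemannianBundle E (fun x : M => TangentSpace 𝓘(ℝ, E) x)]

/-- The Riemannian length of a vector with constant coordinates in the chart at `x` depends on the
base point in an upper semicontinuous way at `x`. -/
theorem eventually_norm_symmL_trivializationAt_lt_of_norm_lt {x : M}
    (u : TangentSpace 𝓘(ℝ, E) x) {a : ℝ} (ha : ‖u‖ < a) :
    ∀ᶠ y in 𝓝 x, ‖(trivializationAt E (TangentSpace 𝓘(ℝ, E)) x).symmL ℝ y
      ((trivializationAt E (TangentSpace 𝓘(ℝ, E)) x).continuousLinearMapAt ℝ x u)‖ < a := by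
  obtain ⟨r, hr, hra⟩ : ∃ r : ℝ, 1 < r ∧ r * ‖u‖ < a := by
    have h1 : ∀ᶠ r in 𝓝[>] (1 : ℝ), r * ‖u‖ < a := by
      refine nhdsWithin_le_nhds ?_
      have : Filter.Tendsto (fun r : ℝ => r * ‖u‖) (𝓝 1) (𝓝 (1 * ‖u‖)) :=
        (continuous_id.mul continuous_const).tendsto _
      exact this.eventually_lt_const (by simpa using ha)
    obtain ⟨r, h2, h3⟩ := (h1.and self_mem_nhdsWithin).exists
    exact ⟨r, h3, h2⟩
  filter_upwards [eventually_norm_symmL_trivializationAt_comp_self_lt E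
    (fun x : M => TangentSpace 𝓘(ℝ, E) x) x hr] with y hy
  refine lt_of_le_of_lt ?_ hra
  refine le_trans ?_ (mul_le_mul_of_nonneg_right hy.le (norm_nonneg u))
  exact ContinuousLinearMap.le_opNorm
    (((trivializationAt E (TangentSpace 𝓘(ℝ, E)) x).symmL ℝ y).comp
      ((trivializationAt E (TangentSpace 𝓘(ℝ, E)) x).continuousLinearMapAt ℝ x)) u

/-- At a point where the gradient of `g` is longer than `1 / c`, there is a constant vector field
`v` in the chart (the coordinates of `-∇g`) along which `g` decreases nearby, faster than the
Riemannian length of `v` divided by `c`. The strict inequality makes this an open condition. -/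
theorem exists_chart_direction [FiniteDimensional ℝ E] {g : M → ℝ} {U : Set M} (hU : IsOpen U)
    (hg : ContMDiffOn 𝓘(ℝ, E) 𝓘(ℝ, ℝ) 1 g U) {x : M} (hx : x ∈ U) {c : M → ℝ}
    (hc : ContinuousAt c x) (hcx : 0 < c x) (hgrad : 1 / c x < ‖riemannianGradient 𝓘(ℝ, E) g x‖) :
    ∃ v : E, ∃ r > 0,
      Metric.ball (extChartAt 𝓘(ℝ, E) x x) r ⊆ (extChartAt 𝓘(ℝ, E) x).target ∧
      ContDiffOn ℝ 1 (g ∘ (extChartAt 𝓘(ℝ, E) x).symm) (Metric.ball (extChartAt 𝓘(ℝ, E) x x) r) ∧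
      ∀ z ∈ Metric.ball (extChartAt 𝓘(ℝ, E) x x) r,
        (extChartAt 𝓘(ℝ, E) x).symm z ∈ U ∧
        fderiv ℝ (g ∘ (extChartAt 𝓘(ℝ, E) x).symm) z v < 0 ∧
        ‖mfderiv 𝓘(ℝ, E) 𝓘(ℝ, E) (extChartAt 𝓘(ℝ, E) x).symm z v‖ <
          c ((extChartAt 𝓘(ℝ, E) x).symm z) *
            -fderiv ℝ (g ∘ (extChartAt 𝓘(ℝ, E) x).symm) z v := by
  set e := extChartAt 𝓘(ℝ, E) x with he
  let N := riemannianGradient 𝓘(ℝ, E) g x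
  have hN : 0 < ‖N‖ := (one_div_pos.2 hcx).trans hgrad
  let v : E := (-N : TangentSpace 𝓘(ℝ, E) x)
  have hdiff : MDifferentiableAt 𝓘(ℝ, E) 𝓘(ℝ, ℝ) g x :=
    ((hg x hx).contMDiffAt (hU.mem_nhds hx)).mdifferentiableAt one_ne_zero
  have hv : fderiv ℝ (g ∘ e.symm) (e x) v = -‖N‖ ^ 2 := by
    rw [he, fderiv_comp_extChartAt_symm hdiff]
    refine (inner_riemannianGradient g x (-N)).symm.trans ?_
    rw [inner_neg_right, real_inner_self_eq_norm_sq]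
  have hsymm : ContinuousAt e.symm (e x) := continuousAt_extChartAt_symm x
  have hexx : e.symm (e x) = x := extChartAt_to_inv x
  have hto : Filter.Tendsto e.symm (𝓝 (e x)) (𝓝 x) := by simpa [hexx] using hsymm.tendsto
  have htarget : e.target ∈ 𝓝 (e x) := extChartAt_target_mem_nhds x
  let O : Set E := e.target ∩ e.symm ⁻¹' U
  have hO : IsOpen O := (continuousOn_extChartAt_symm x).isOpen_inter_preimage
    (isOpen_extChartAt_target x) hU
  have hxO : e x ∈ O := ⟨mem_extChartAt_target x, by simpa [hexx] using hx⟩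
  have hsmooth : ContDiffOn ℝ 1 (g ∘ e.symm) O := by
    rw [← contMDiffOn_iff_contDiffOn]
    exact hg.comp ((contMDiffOn_extChartAt_symm x).mono Set.inter_subset_left) fun z hz => hz.2
  have hDc : ContinuousAt (fun z => fderiv ℝ (g ∘ e.symm) z v) (e x) :=
    ((hsmooth.continuousOn_fderiv_of_isOpen hO le_rfl).continuousAt
      (hO.mem_nhds hxO)).clm_apply continuousAt_const
  have hneg : ∀ᶠ z in 𝓝 (e x), fderiv ℝ (g ∘ e.symm) z v < 0 := by
    refine hDc.eventually_lt continuousAt_const ?_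
    rw [hv]
    nlinarith
  -- a number strictly between the two sides of the last inequality at the base point
  obtain ⟨a, ha1, ha2⟩ : ∃ a, ‖-N‖ < a ∧ a < c x * ‖N‖ ^ 2 := by
    refine exists_between ?_
    rw [norm_neg, pow_two, ← mul_assoc]
    have : 1 < c x * ‖N‖ := by rwa [div_lt_iff₀' hcx] at hgrad
    nlinarith
  have hright : ∀ᶠ z in 𝓝 (e x), a < c (e.symm z) * -fderiv ℝ (g ∘ e.symm) z v := by
    have h1 : ContinuousAt (fun z => c (e.symm z)) (e x) :=
      ContinuousAt.comp (g := c) (by rwa [hexx]) hsymm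
    refine continuousAt_const.eventually_lt (h1.mul hDc.neg) ?_
    rw [hv, hexx, neg_neg]
    exact ha2
  have hleft : ∀ᶠ z in 𝓝 (e x), ‖mfderiv 𝓘(ℝ, E) 𝓘(ℝ, E) e.symm z v‖ < a := by
    filter_upwards [hto.eventually (eventually_norm_symmL_trivializationAt_lt_of_norm_lt _ ha1),
      htarget] with z hz hzt
    have hy : e.symm z ∈ (chartAt E x).source := by simpa [e] using e.map_target hzt
    rw [TangentBundle.symmL_trivializationAt hy,
      TangentBundle.continuousLinearMapAt_trivializationAt (mem_chart_source E x),
      mfderiv_extChartAt_self] at hz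
    have hez : e (e.symm z) = z := e.right_inv hzt
    rw [← he, hez, modelWithCornersSelf_coe, Set.range_id, mfderivWithin_univ] at hz
    exact hz
  obtain ⟨r, hr, hball⟩ := Metric.eventually_nhds_iff_ball.1
    ((hO.eventually_mem hxO).and (hneg.and (hleft.and hright)))
  refine ⟨v, r, hr, fun z hz => (hball z hz).1.1, hsmooth.mono fun z hz => (hball z hz).1,
    fun z hz => ?_⟩
  obtain ⟨h1, h2, h3, h4⟩ := hball z hz
  exact ⟨h1.2, h2, h3.trans h4⟩

end Chart

section Segment

variable {E : Type*} [NormedAddCommGroup E] [NormedSpace ℝ E]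

theorem hasDerivAt_add_smul (z v : E) (t : ℝ) : HasDerivAt (fun t : ℝ => z + t • v) v t := by
  simpa using ((hasDerivAt_id t).smul_const v).const_add z

variable {M : Type*} [TopologicalSpace M] [ChartedSpace E M]

theorem strictAntiOn_add_smul {f : E → ℝ} {B : Set E} (hB : IsOpen B) (hf : ContDiffOn ℝ 1 f B)
    {v : E} (hv : ∀ z ∈ B, fderiv ℝ f z v < 0) {z : E} {T : ℝ}
    (hseg : ∀ t ∈ Set.Icc 0 T, z + t • v ∈ B) :
    StrictAntiOn (fun t : ℝ => f (z + t • v)) (Set.Icc 0 T) := by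
  have hd : ∀ t ∈ Set.Icc 0 T, HasDerivAt (fun t : ℝ => f (z + t • v))
      (fderiv ℝ f (z + t • v) v) t := fun t ht => by
    have h1 : HasFDerivAt f (fderiv ℝ f (z + t • v)) (z + t • v) :=
      ((hf.contDiffAt (hB.mem_nhds (hseg t ht))).differentiableAt one_ne_zero).hasFDerivAt
    exact h1.comp_hasDerivAt t (hasDerivAt_add_smul z v t)
  refine strictAntiOn_of_deriv_neg (convex_Icc 0 T)
    (fun t ht => (hd t ht).continuousAt.continuousWithinAt) fun t ht => ?_
  rw [(hd t (interior_subset ht)).deriv]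
  exact hv _ (hseg t (interior_subset ht))

variable
  [Bundle.RiemannianBundle (fun x : M => TangentSpace 𝓘(ℝ, E) x)] [IsManifold 𝓘(ℝ, E) 1 M]

/-- If along the coordinate segments in the direction `v` the Riemannian speed is at most
`φ (g)` times the rate at which `g` decreases, then the distance between the ends of such a segment
is at most the amount by which a primitive of `φ` drops. -/
theorem riemannianEDist_extChartAt_symm_add_smul_le {g : M → ℝ} {x : M} {B : Set E}
    (hB : IsOpen B) (hBt : B ⊆ (extChartAt 𝓘(ℝ, E) x).target)
    (hf : ContDiffOn ℝ 1 (g ∘ (extChartAt 𝓘(ℝ, E) x).symm) B)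
    {φ Φ : ℝ → ℝ} {b : ℝ} (hφ : ContinuousOn φ (Set.Iic b))
    (hφ0 : ∀ t ≤ b, 0 < φ t) (hΦ : ∀ t ≤ b, HasDerivWithinAt Φ (φ t) (Set.Iic b) t)
    {v : E} (hv : ∀ z ∈ B, fderiv ℝ (g ∘ (extChartAt 𝓘(ℝ, E) x).symm) z v < 0)
    (hnorm : ∀ z ∈ B, g ((extChartAt 𝓘(ℝ, E) x).symm z) ≤ b →
      ‖mfderiv 𝓘(ℝ, E) 𝓘(ℝ, E) (extChartAt 𝓘(ℝ, E) x).symm z v‖ ≤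
        φ (g ((extChartAt 𝓘(ℝ, E) x).symm z)) *
          -fderiv ℝ (g ∘ (extChartAt 𝓘(ℝ, E) x).symm) z v)
    {z : E} {T : ℝ} (hT : 0 ≤ T) (hseg : ∀ t ∈ Set.Icc 0 T, z + t • v ∈ B)
    (hz : g ((extChartAt 𝓘(ℝ, E) x).symm z) ≤ b) :
    Manifold.riemannianEDist 𝓘(ℝ, E) ((extChartAt 𝓘(ℝ, E) x).symm z)
        ((extChartAt 𝓘(ℝ, E) x).symm (z + T • v)) ≤
      ENNReal.ofReal (Φ (g ((extChartAt 𝓘(ℝ, E) x).symm z)) -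
        Φ (g ((extChartAt 𝓘(ℝ, E) x).symm (z + T • v)))) := by
  set e := extChartAt 𝓘(ℝ, E) x with he
  set f := g ∘ e.symm with hfdef
  let η : ℝ → E := fun t => z + t • v
  have hηd : ∀ t, HasDerivAt η v t := hasDerivAt_add_smul z v
  have hηc : Continuous η := by fun_prop
  have hηs : ContDiff ℝ 1 η := by fun_prop
  have hmaps : Set.MapsTo η (Set.Icc 0 T) B := hseg
  have hanti := strictAntiOn_add_smul hB hf hv hseg
  have hle : Set.MapsTo (f ∘ η) (Set.Icc 0 T) (Set.Iic b) := fun t ht => by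
    have h1 := hanti.antitoneOn ⟨le_rfl, hT⟩ ht ht.1
    have h2 : f (z + (0 : ℝ) • v) ≤ b := by simpa [hfdef] using hz
    exact h1.trans h2
  have hfη : ∀ t ∈ Set.Icc 0 T, HasDerivAt (f ∘ η) (fderiv ℝ f (η t) v) t := fun t ht =>
    HasFDerivAt.comp_hasDerivAt t
      ((hf.contDiffAt (hB.mem_nhds (hmaps ht))).differentiableAt one_ne_zero).hasFDerivAt (hηd t)
  let k : ℝ → ℝ := fun t => φ (f (η t)) * -fderiv ℝ f (η t) v
  have hk0 : ∀ t ∈ Set.Icc 0 T, 0 ≤ k t := fun t ht =>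
    mul_nonneg (hφ0 _ (hle ht)).le (neg_nonneg.2 (hv _ (hmaps ht)).le)
  have hkc : ContinuousOn k (Set.Icc 0 T) := by
    refine ContinuousOn.mul (hφ.comp (fun t ht => (hfη t ht).continuousAt.continuousWithinAt) hle)
      (ContinuousOn.neg ?_)
    exact ((hf.continuousOn_fderiv_of_isOpen hB le_rfl).comp hηc.continuousOn hmaps).clm_apply
      continuousOn_const
  have hh : ∀ t ∈ Set.Icc 0 T, HasDerivWithinAt (fun t => -Φ (f (η t))) (k t) (Set.Icc 0 T) t := by
    intro t ht
    have h1 := ((hΦ _ (hle ht)).comp t (hfη t ht).hasDerivWithinAt hle).neg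
    have h2 : k t = -(φ ((f ∘ η) t) * fderiv ℝ f (η t) v) := by
      simp [k]
    rw [h2]
    exact h1
  have hint : ∫ t in (0 : ℝ)..T, k t = Φ (f (η 0)) - Φ (f (η T)) := by
    rw [intervalIntegral.integral_eq_sub_of_hasDerivAt_of_le (f := fun t => -Φ (f (η t))) hT
      (fun t ht => (hh t ht).continuousWithinAt)
      (fun t ht => (hh t (Set.Ioo_subset_Icc_self ht)).hasDerivAt (Icc_mem_nhds ht.1 ht.2))
      (hkc.intervalIntegrable_of_Icc hT)]
    ring
  have hγ : ContMDiffOn 𝓘(ℝ, ℝ) 𝓘(ℝ, E) 1 (e.symm ∘ η) (Set.Icc 0 T) :=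
    (contMDiffOn_extChartAt_symm x).comp (contMDiffOn_iff_contDiffOn.2 hηs.contDiffOn)
      fun t ht => hBt (hmaps ht)
  have hspeed : ∀ t ∈ Set.Icc 0 T, ‖mfderiv 𝓘(ℝ, ℝ) 𝓘(ℝ, E) (e.symm ∘ η) t 1‖ₑ ≤
      ENNReal.ofReal (k t) := by
    intro t ht
    have h1 : MDifferentiableAt 𝓘(ℝ, E) 𝓘(ℝ, E) e.symm (η t) :=
      ((contMDiffOn_extChartAt_symm (n := 1) x).contMDiffAt
        ((isOpen_extChartAt_target x).mem_nhds (hBt (hmaps ht)))).mdifferentiableAt one_ne_zero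
    have h2 : HasMFDerivAt 𝓘(ℝ, ℝ) 𝓘(ℝ, E) η t (ContinuousLinearMap.toSpanSingleton ℝ v) :=
      (hηd t).hasFDerivAt.hasMFDerivAt
    have h3 := (h1.hasMFDerivAt.comp t h2).mfderiv
    have h4 : mfderiv 𝓘(ℝ, ℝ) 𝓘(ℝ, E) (e.symm ∘ η) t (1 : ℝ) =
        mfderiv 𝓘(ℝ, E) 𝓘(ℝ, E) e.symm (η t) v := by
      rw [h3]
      change mfderiv 𝓘(ℝ, E) 𝓘(ℝ, E) e.symm (η t) ((1 : ℝ) • v) = _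
      rw [one_smul]
    refine (congrArg (‖·‖ₑ) h4).trans_le ?_
    rw [← ofReal_norm]
    exact ENNReal.ofReal_le_ofReal (hnorm _ (hmaps ht) (hle ht))
  have hdist := Manifold.riemannianEDist_le_pathELength hγ (x := e.symm z) (y := e.symm (z + T • v))
    (by simp [η]) rfl hT
  refine hdist.trans ?_
  rw [Manifold.pathELength_eq_lintegral_mfderiv_Icc]
  refine (MeasureTheory.setLIntegral_mono' measurableSet_Icc hspeed).trans_eq ?_
  rw [← MeasureTheory.ofReal_integral_eq_lintegral_ofReal hkc.integrableOn_Icc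
    ((MeasureTheory.ae_restrict_iff' measurableSet_Icc).2 (.of_forall hk0)),
    MeasureTheory.integral_Icc_eq_integral_Ioc, ← intervalIntegral.integral_of_le hT, hint]
  simp [η, hfdef]

variable [IsContinuousRiemannianBundle E (fun x : M => TangentSpace 𝓘(ℝ, E) x)]

/-- Near a point where the gradient of `g` is longer than `1 / φ (g)`, moving along segments in the
chart is a local homotopy which lowers `g` and moves points by at most the drop of `Φ ∘ g`. -/
theorem exists_local_descent [FiniteDimensional ℝ E] {g : M → ℝ} {U : Set M} (hU : IsOpen U)
    (hg : ContMDiffOn 𝓘(ℝ, E) 𝓘(ℝ, ℝ) 1 g U) {φ Φ : ℝ → ℝ} {b : ℝ}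
    (hφ : ContinuousOn φ (Set.Iic b)) (hφ0 : ∀ t ≤ b, 0 < φ t)
    (hΦ : ∀ t ≤ b, HasDerivWithinAt Φ (φ t) (Set.Iic b) t) {x : M} (hx : x ∈ U) (hxb : g x ≤ b)
    (hgrad : 1 / φ (g x) < ‖riemannianGradient 𝓘(ℝ, E) g x‖) :
    ∃ V : Set M, IsOpen V ∧ x ∈ V ∧ V ⊆ U ∧ ∃ L : I × M → M, ContinuousOn L (Set.univ ×ˢ V) ∧
      (∀ y ∈ V, L (0, y) = y) ∧ g (L (1, x)) < g x ∧ ∀ t, ∀ y ∈ V, L (t, y) ∈ U ∧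
        (g y ≤ b → g (L (t, y)) ≤ g y ∧
          Manifold.riemannianEDist 𝓘(ℝ, E) y (L (t, y)) ≤
            ENNReal.ofReal (Φ (g y) - Φ (g (L (t, y))))) := by
  -- `φ` is continuous on `(-∞, b]` only, hence the truncation
  have hc : ContinuousAt (fun y => φ (min (g y) b)) x := by
    have h1 : Continuous fun s : ℝ => φ (min s b) :=
      hφ.comp_continuous (by fun_prop) fun s => min_le_right s b
    exact h1.continuousAt.comp (hg.continuousOn.continuousAt (hU.mem_nhds hx))
  obtain ⟨v, r, hr, hBt, hf, hv⟩ := exists_chart_direction hU hg hx hc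
    (hφ0 _ (min_le_right _ _)) (by rwa [min_eq_left hxb])
  set e := extChartAt 𝓘(ℝ, E) x with he
  set B := Metric.ball (e x) r with hBdef
  obtain ⟨κ, hκ, hκv⟩ : ∃ κ : ℝ, 0 < κ ∧ κ * ‖v‖ < r / 2 := by
    refine ⟨r / 2 / (‖v‖ + 1), by positivity, ?_⟩
    rw [div_mul_eq_mul_div, div_lt_iff₀ (by positivity)]
    nlinarith [norm_nonneg v]
  let V : Set M := e.source ∩ e ⁻¹' Metric.ball (e x) (r / 2)
  have hV : IsOpen V := (continuousOn_extChartAt x).isOpen_inter_preimage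
    (isOpen_extChartAt_source x) Metric.isOpen_ball
  have hxV : x ∈ V := ⟨mem_extChartAt_source x, by simp [hr]⟩
  have hseg : ∀ y ∈ V, ∀ t : ℝ, t ∈ Set.Icc 0 κ → e y + t • v ∈ B := by
    intro y hy t ht
    have h1 : dist (e y) (e x) < r / 2 := hy.2
    rw [hBdef, Metric.mem_ball, dist_eq_norm]
    rw [dist_eq_norm] at h1
    calc ‖e y + t • v - e x‖ = ‖(e y - e x) + t • v‖ := by congr 1; abel
      _ ≤ ‖e y - e x‖ + t * ‖v‖ := by
        refine (norm_add_le _ _).trans ?_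
        rw [norm_smul, Real.norm_of_nonneg ht.1]
      _ ≤ ‖e y - e x‖ + κ * ‖v‖ := by gcongr; exact ht.2
      _ < r := by linarith
  have hIκ : ∀ t : I, (t : ℝ) * κ ∈ Set.Icc 0 κ := fun t =>
    ⟨mul_nonneg t.2.1 hκ.le, mul_le_of_le_one_left hκ.le t.2.2⟩
  have hey : ∀ y ∈ V, e.symm (e y) = y := fun y hy => e.left_inv hy.1
  have hanti : ∀ y ∈ V, StrictAntiOn (fun t : ℝ => g (e.symm (e y + t • v))) (Set.Icc 0 κ) :=
    fun y hy => strictAntiOn_add_smul Metric.isOpen_ball hf (fun z hz => (hv z hz).2.1) (hseg y hy)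
  refine ⟨V, hV, hxV, fun y hy => ?_, fun q => e.symm (e q.2 + ((q.1 : ℝ) * κ) • v), ?_, ?_, ?_, ?_⟩
  · have h1 := (hv _ (hseg y hy 0 ⟨le_rfl, hκ.le⟩)).1
    simpa [hey y hy] using h1
  · refine (continuousOn_extChartAt_symm x).comp (ContinuousOn.add ?_ (by fun_prop)) ?_
    · exact (continuousOn_extChartAt x).comp continuousOn_snd fun q hq => hq.2.1
    · exact fun q hq => hBt (hseg _ hq.2 _ (hIκ q.1))
  · intro y hy
    simp [hey y hy]
  · have h1 := hanti x hxV ⟨le_rfl, hκ.le⟩ ⟨hκ.le, le_rfl⟩ hκ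
    simpa [hey x hxV] using h1
  · intro t y hy
    refine ⟨(hv _ (hseg y hy _ (hIκ t))).1, fun hyb => ⟨?_, ?_⟩⟩
    · have h1 := (hanti y hy).antitoneOn ⟨le_rfl, hκ.le⟩ (hIκ t) (hIκ t).1
      simpa [hey y hy] using h1
    · have h1 := riemannianEDist_extChartAt_symm_add_smul_le Metric.isOpen_ball hBt hf hφ hφ0 hΦ
        (fun z hz => (hv z hz).2.1) (fun z hz hzb => by
          have := (hv z hz).2.2.le
          rwa [min_eq_left hzb] at this) (hIκ t).1
        (fun s hs => hseg y hy s ⟨hs.1, hs.2.trans (hIκ t).2⟩) (by rwa [← he, hey y hy])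
      rwa [← he, hey y hy] at h1

end Segment

/-! ### The potential of a fast decreasing function -/

/-- A bounded primitive of a positive function on `(-∞, b]` increases from its limit at `-∞`. -/
theorem exists_tendsto_atBot_of_primitive {φ Φ : ℝ → ℝ} {b : ℝ} (hφ0 : ∀ t ≤ b, 0 < φ t)
    (hΦ : ∀ t ≤ b, HasDerivWithinAt Φ (φ t) (Set.Iic b) t) {C : ℝ} (hC : ∀ t ≤ b, |Φ t| ≤ C) :
    StrictMonoOn Φ (Set.Iic b) ∧
      ∃ m, (∀ t ≤ b, m < Φ t) ∧ Filter.Tendsto Φ Filter.atBot (𝓝 m) := by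
  have hmono : StrictMonoOn Φ (Set.Iic b) := by
    refine strictMonoOn_of_deriv_pos (convex_Iic b) (fun t ht => (hΦ t ht).continuousWithinAt)
      fun t ht => ?_
    rw [interior_Iic] at ht
    rw [((hΦ t ht.le).hasDerivAt (Iic_mem_nhds ht)).deriv]
    exact hφ0 t ht.le
  have hbdd : BddBelow (Φ '' Set.Iic b) :=
    ⟨-C, Set.forall_mem_image.2 fun t ht => (abs_le.1 (hC t ht)).1⟩
  have hle : ∀ t ≤ b, sInf (Φ '' Set.Iic b) ≤ Φ t := fun t ht =>
    csInf_le hbdd (Set.mem_image_of_mem Φ ht)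
  refine ⟨hmono, sInf (Φ '' Set.Iic b), fun t ht => ?_, ?_⟩
  · have ht' : t - 1 < t := by linarith
    exact (hle (t - 1) (ht'.le.trans ht)).trans_lt (hmono (ht'.le.trans ht) ht ht')
  · refine tendsto_order.2 ⟨fun a ha => ?_, fun a ha => ?_⟩
    · filter_upwards [Filter.eventually_le_atBot b] with t ht
      exact ha.trans_le (hle t ht)
    · obtain ⟨_, ⟨s, hs, rfl⟩, hsa⟩ := exists_lt_of_csInf_lt (Set.nonempty_Iic.image Φ) ha
      filter_upwards [Filter.eventually_le_atBot s] with t ht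
      exact (hmono.monotoneOn (ht.trans hs) hs ht).trans_lt hsa

open Classical in
/-- A function which tends to `-∞` at `S` becomes continuous on the whole space after composition
with a continuous function that has a limit at `-∞`, if that limit is the value on `S`. -/
theorem continuous_ite_of_tendsto_atBot {M : Type*} [TopologicalSpace M] {S : Set M}
    (hS : IsClosed S) {g : M → ℝ} (hg : ContinuousOn g Sᶜ)
    (hgS : ∀ z ∈ S, Filter.Tendsto g (𝓝[Sᶜ] z) Filter.atBot) {ψ : ℝ → ℝ} (hψ : Continuous ψ)
    {m : ℝ} (hm : Filter.Tendsto ψ Filter.atBot (𝓝 m)) :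
    Continuous fun y => if y ∈ S then m else ψ (g y) := by
  rw [continuous_iff_continuousAt]
  intro y
  by_cases hy : y ∈ S
  · rw [ContinuousAt, if_pos hy, ← nhdsWithin_univ, ← Set.union_compl_self S, nhdsWithin_union]
    refine Filter.Tendsto.sup ?_ ?_
    · refine tendsto_const_nhds.congr' ?_
      filter_upwards [self_mem_nhdsWithin] with z hz
      exact (if_pos hz).symm
    · refine (hm.comp (hgS y hy)).congr' ?_
      filter_upwards [self_mem_nhdsWithin] with z hz
      exact (if_neg hz).symm
  · have hU : Sᶜ ∈ 𝓝 y := hS.isOpen_compl.mem_nhds hy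
    refine ((hψ.continuousAt).comp (hg.continuousAt hU)).congr ?_
    filter_upwards [hU] with z hz
    exact (if_neg hz).symm

/-! ### The deformation retraction -/

theorem lemma2 (n : ℕ) (M : Type*) [TopologicalSpace M] [T2Space M]
    [ChartedSpace (EuclideanSpace ℝ (Fin n)) M] [IsManifold (𝓡 n) ∞ M]
    [Bundle.RiemannianBundle (fun x : M => TangentSpace (𝓡 n) x)]
    [IsContMDiffRiemannianBundle (𝓡 n) ∞ (EuclideanSpace ℝ (Fin n))
      (fun x : M => TangentSpace (𝓡 n) x)]
    (S : Set M) (hS : IsCompact S) (g : M → ℝ) (b : ℝ)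
    (hg : ContMDiffOn (𝓡 n) 𝓘(ℝ, ℝ) 2 g Sᶜ)
    (hfast : IsFastDecreasing (𝓡 n) S g b)
    (hcpt : IsCompact ({x : M | x ∉ S ∧ g x ≤ b} ∪ S)) :
    IsStrongDeformationRetract S ({x : M | x ∉ S ∧ g x ≤ b} ∪ S) := by
  classical
  have : IsManifold (𝓡 n) 1 M := .of_le (n := ∞) (by exact_mod_cast le_top)
  have : IsContinuousRiemannianBundle (EuclideanSpace ℝ (Fin n))
      (fun x : M => TangentSpace (𝓡 n) x) :=
    Bundle.IsContMDiffRiemannianBundle.isContinuousRiemannianBundle (n := ∞) inferInstance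
  have : LocallyCompactSpace M := Manifold.locallyCompact_of_finiteDimensional (𝓡 n)
  obtain ⟨hgS, φ, hφ, hφ0, ⟨Φ, hΦ, C, hC⟩, hgrad⟩ := hfast
  obtain ⟨hmono, m, hm, hmlim⟩ := exists_tendsto_atBot_of_primitive hφ0 hΦ hC
  have hU : IsOpen Sᶜ := hS.isClosed.isOpen_compl
  set A : Set M := {x : M | x ∉ S ∧ g x ≤ b} ∪ S with hA
  have hAb : ∀ y ∈ A, y ∉ S → g y ≤ b := fun y hy hyS => (hy.resolve_right hyS).2
  -- the potential: the drop of `Φ ∘ g` that remains, which is `0` on `S`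
  let W : M → ℝ := fun y => if y ∈ S then m else Φ (min (g y) b)
  have hWc : Continuous W := by
    refine continuous_ite_of_tendsto_atBot (ψ := fun s => Φ (min s b)) hS.isClosed
      hg.continuousOn hgS ?_ ?_
    · exact ContinuousOn.comp_continuous (fun t ht => (hΦ t ht).continuousWithinAt) (by fun_prop)
        fun s => min_le_right s b
    · refine hmlim.congr' ?_
      filter_upwards [Filter.eventually_le_atBot b] with t ht
      rw [min_eq_left ht]
  have hWS : ∀ y ∈ S, W y = m := fun y hy => if_pos hy
  have hWA : ∀ y, y ∉ S → g y ≤ b → W y = Φ (g y) := fun y hy hyb => by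
    simp [W, hy, min_eq_left hyb]
  let w : A → ℝ≥0 := fun p => (W p - m).toNNReal
  have hwc : Continuous w := by fun_prop
  have hw0 : ∀ p : A, w p = 0 ↔ (p : M) ∈ S := by
    intro p
    rw [Real.toNNReal_eq_zero, sub_nonpos]
    refine ⟨fun h => by_contra fun hp => ?_, fun hp => (hWS p hp).le⟩
    rw [hWA p hp (hAb p p.2 hp)] at h
    exact (hm _ (hAb p p.2 hp)).not_ge h
  let : EMetricSpace M := .ofRiemannianMetric (𝓡 n) M
  have : CompactSpace A := isCompact_iff_compactSpace.1 hcpt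
  obtain ⟨G, hG0, hG1, hGS⟩ := exists_deformation_onto_zeros (X := A) hwc fun p hp => by
    have hpS : (p : M) ∉ S := fun h => hp ((hw0 p).2 h)
    have hpb := hAb p p.2 hpS
    obtain ⟨V, hV, hpV, hVU, L, hLc, hL0, hL1, hL⟩ := exists_local_descent hU
      (hg.of_le one_le_two) hφ hφ0 hΦ hpS hpb (hgrad p hpS hpb)
    have hLA : ∀ t, ∀ q : A, (q : M) ∈ V → L (t, q) ∈ A := fun t q hq =>
      .inl ⟨(hL t q hq).1, ((hL t q hq).2 (hAb q q.2 (hVU hq))).1.trans (hAb q q.2 (hVU hq))⟩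
    let L' : I × A → A := fun q => if h : L (q.1, q.2) ∈ A then ⟨L (q.1, q.2), h⟩ else q.2
    have hL' : ∀ t, ∀ q : A, (q : M) ∈ V → (L' (t, q) : M) = L (t, q) := fun t q hq => by
      simp only [L', dif_pos (hLA t q hq)]
    have hL'c : ContinuousOn L' (Set.univ ×ˢ (Subtype.val ⁻¹' V)) := by
      rw [Topology.IsInducing.subtypeVal.continuousOn_iff]
      refine ContinuousOn.congr (f := fun q : I × A => L (q.1, q.2)) ?_ fun q hq => hL' q.1 q.2 hq.2
      exact hLc.comp (by fun_prop) fun q hq => ⟨trivial, hq.2⟩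
    obtain ⟨H, hH, hH1⟩ := exists_isDescent_of_local (w := w) (hV.preimage continuous_subtype_val)
      (show p ∈ Subtype.val ⁻¹' V from hpV) L' hL'c
      (fun q hq => Subtype.ext ((hL' 0 q hq).trans (hL0 q hq))) fun t q hq => by
        have h1 := hL t q hq
        have hqb := hAb q q.2 (hVU hq)
        have h2 := h1.2 hqb
        have h3 : g (L (t, q)) ≤ b := h2.1.trans hqb
        change edist (q : M) (L' (t, q) : M) + ENNReal.ofReal (W (L' (t, q)) - m) ≤
          ENNReal.ofReal (W q - m)
        rw [hL' t q hq, hWA _ h1.1 h3, hWA _ (hVU hq) hqb]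
        calc edist (q : M) (L (t, q)) + ENNReal.ofReal (Φ (g (L (t, q))) - m)
            ≤ ENNReal.ofReal (Φ (g q) - Φ (g (L (t, q)))) +
              ENNReal.ofReal (Φ (g (L (t, q))) - m) := by
              gcongr
              exact h2.2
          _ = ENNReal.ofReal (Φ (g q) - m) := by
            rw [← ENNReal.ofReal_add (sub_nonneg.2 (hmono.monotoneOn h3 hqb h2.1))
              (sub_nonneg.2 (hm _ h3).le), sub_add_sub_cancel]
    refine ⟨H, hH, ?_⟩
    have h1 := hL 1 p hpV
    have h2 : g (L (1, p)) ≤ b := (h1.2 hpb).1.trans hpb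
    rw [hH1]
    simp only [w, hL' 1 p hpV]
    rw [hWA _ h1.1 h2, hWA _ hpS hpb, Real.toNNReal_lt_toNNReal_iff (sub_pos.2 (hm _ hpb))]
    exact sub_lt_sub_right (hmono h2 hpb hL1) m
  refine ⟨Set.subset_union_right, ⟨fun p => G (1, p), by fun_prop⟩, fun p => (hw0 _).1 (hG1 p),
    ⟨⟨⟨G, hG0, fun p => rfl⟩, fun t p hp => hGS t p ((hw0 p).2 hp)⟩⟩⟩
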